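/- Let $\Lambda$ be a ring and let $F\colon(\operatorname{Mod}\Lambda)^{\mathrm{op}}\to\mathrm{Ab}$ be an additive functor that preserves filtered colimits in $\operatorname{Mod}\Lambda$, in the sense appropriate for a contravariant functor: for every small filtered diagram $(M_i)_{i\in I}$ of $\Lambda$-modules the canonical map $F(\operatorname{colim}_i M_i)\to\lim_i F(M_i)$ is an isomorphism. Then $F$ admits a minimal presentation, that is, there are $\Lambda$-modules $X,Y$ and an exact sequence of functors $(\operatorname{Mod}\Lambda)^{\mathrm{op}}\to\mathrm{Ab}$ (exactness being pointwise) $$\operatorname{Hom}_\Lambda(-,X)\longrightarrow\operatorname{Hom}_\Lambda(-,Y)\longrightarrow F\longrightarrow 0$$ in which both morphisms $\operatorname{Hom}_\Lambda(-,Y)\to F$ and $\operatorname{Hom}_\Lambda(-,X)\to\operatorname{Hom}_\Lambda(-,Y)$ are right minimal. Here a morphism $\alpha\colon A\to B$ is called right minimal if every endomorphism $\phi\colon A\to A$ with $\alpha\phi=\alpha$ is invertible. -/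

import Mathlib

open CategoryTheory CategoryTheory.Limits Opposite

universe v u

/-- A morphism `α : X ⟶ Y` is right minimal if every endomorphism `φ` of `X` with `α ∘ φ = α`
is invertible. -/
def RightMinimal {C : Type u} [Category.{v} C] {X Y : C} (α : X ⟶ Y) : Prop :=
  ∀ φ : X ⟶ X, φ ≫ α = α → IsIso φ

/-- A minimal presentation of a functor `F : Cᵒᵖ ⥤ Ab`: an exact sequence
`Hom(-, X) ⟶ Hom(-, Y) ⟶ F ⟶ 0` in the abelian category of functors `Cᵒᵖ ⥤ Ab` (where exactness
is pointwise), both of whose morphisms `Hom(-, X) ⟶ Hom(-, Y)` and `Hom(-, Y) ⟶ F` are right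
minimal. -/
structure MinimalPresentation {C : Type u} [Category.{v} C] [Preadditive C]
    (F : Cᵒᵖ ⥤ AddCommGrpCat.{v}) where
  /-- the object representing the relations -/
  X : C
  /-- the object representing the generators -/
  Y : C
  /-- the morphism `Hom(-, X) ⟶ Hom(-, Y)` -/
  f : preadditiveYoneda.obj X ⟶ preadditiveYoneda.obj Y
  /-- the morphism `Hom(-, Y) ⟶ F` -/
  p : preadditiveYoneda.obj Y ⟶ F
  zero : f ≫ p = 0
  exact : (ShortComplex.mk f p zero).Exact
  epi : Epi p
  rightMinimal_f : RightMinimal f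
  rightMinimal_p : RightMinimal p

/-! By Yoneda, a morphism `Hom(-, Y) ⟶ F` is an element `y` of `F Y`. It is epi when `y` is weakly
terminal, and right minimal when every endomorphism of `Y` fixing `y` is bijective. Such an element
is found among the reduced ones, where injectivity of these endomorphisms is automatic.

Zorn's lemma makes every element a pullback of a reduced one (`exists_elemReduced`). The heart is
`card_le_of_elemReduced`: reduced elements live on modules of bounded size. If `M` is too large, a
Löwenheim–Skolem argument gives a small submodule `N` not contained in a set `B`, and a map `N → M`
with values in `B` that pulls `x` back to the same element as the inclusion does. The difference `d`
of the two maps is nonzero, and `N` is closed under enough linear systems for `M → M / range d` and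
`N → range d` to be pure epimorphisms. Then `x` extends along `M → M / range d`
(`exists_extension_of_pure`), so it is not reduced.

The bound leaves a set of reduced elements up to isomorphism, and a direct sum yields a weakly
terminal element. If each reduced weakly terminal element had a non-surjective endomorphism,
transfinite iteration would produce a reduced element beyond the bound (`exists_isGood_surjective`).
The kernel of `Hom(-, Y) ⟶ F` inherits the hypotheses, so the construction applies again. -/

/-! ### Pullback and gluing of elements -/

/-- Pullback of elements of a contravariant functor on modules along a linear map. -/
def elemPull {Λ : Type u} [Ring Λ] (F : (ModuleCat.{u} Λ)ᵒᵖ ⥤ AddCommGrpCat.{u})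
    {M N : Type u} [AddCommGroup M] [Module Λ M] [AddCommGroup N] [Module Λ N] (f : M →ₗ[Λ] N) :
    F.obj (op (ModuleCat.of Λ N)) →+ F.obj (op (ModuleCat.of Λ M)) :=
  (F.map (ModuleCat.ofHom f).op).hom

namespace elemPull

variable {Λ : Type u} [Ring Λ] (F : (ModuleCat.{u} Λ)ᵒᵖ ⥤ AddCommGrpCat.{u})
  {M N P : Type u} [AddCommGroup M] [Module Λ M] [AddCommGroup N] [Module Λ N]
  [AddCommGroup P] [Module Λ P]

lemma comp (f : M →ₗ[Λ] N) (g : N →ₗ[Λ] P) (x : F.obj (op (ModuleCat.of Λ P))) :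
    elemPull F (g ∘ₗ f) x = elemPull F f (elemPull F g x) := by
  simp [elemPull, ModuleCat.ofHom_comp]

lemma id (x : F.obj (op (ModuleCat.of Λ M))) : elemPull F LinearMap.id x = x := by
  simp [elemPull]

variable [F.Additive]

lemma add (f g : M →ₗ[Λ] N) (x : F.obj (op (ModuleCat.of Λ N))) :
    elemPull F (f + g) x = elemPull F f x + elemPull F g x := by
  have : ModuleCat.ofHom (f + g) = ModuleCat.ofHom f + ModuleCat.ofHom g := rfl
  simp [elemPull, this, Functor.map_add]

lemma zero (x : F.obj (op (ModuleCat.of Λ N))) :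
    elemPull F (0 : M →ₗ[Λ] N) x = 0 := by
  have h := add F (0 : M →ₗ[Λ] N) 0 x
  simpa using h

lemma sub (f g : M →ₗ[Λ] N) (x : F.obj (op (ModuleCat.of Λ N))) :
    elemPull F (f - g) x = elemPull F f x - elemPull F g x := by
  rw [eq_sub_iff_add_eq, ← add, sub_add_cancel]

end elemPull

/-- Elements glue uniquely along a directed colimit of modules. -/
lemma existsUnique_glue {Λ : Type u} [Ring Λ] (F : (ModuleCat.{u} Λ)ᵒᵖ ⥤ AddCommGrpCat.{u})
    [PreservesCofilteredLimitsOfSize.{u, u} F] {ι : Type u} [Preorder ι] [IsDirectedOrder ι]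
    [Nonempty ι] (D : ι ⥤ ModuleCat.{u} Λ) {M : Type u} [AddCommGroup M] [Module Λ M]
    (c : ∀ i, D.obj i →ₗ[Λ] M)
    (hc : ∀ i j (h : i ≤ j), c j ∘ₗ (D.map (homOfLE h)).hom = c i)
    (hsurj : ∀ m, ∃ i y, c i y = m)
    (hker : ∀ i y, c i y = 0 → ∃ j, ∃ h : i ≤ j, (D.map (homOfLE h)).hom y = 0)
    (x : ∀ i, F.obj (op (ModuleCat.of Λ (D.obj i))))
    (hx : ∀ i j (h : i ≤ j), elemPull F (D.map (homOfLE h)).hom (x j) = x i) :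
    ∃! y : F.obj (op (ModuleCat.of Λ M)), ∀ i, elemPull F (c i) y = x i := by
  let t : Cocone D :=
    { pt := ModuleCat.of Λ M
      ι := { app i := ModuleCat.ofHom (c i)
             naturality i j f := by
              ext y
              exact LinearMap.congr_fun (hc i j (leOfHom f)) y } }
  have ht : Nonempty (IsColimit t) := by
    refine ⟨isColimitOfReflects (forget (ModuleCat.{u} Λ)) ?_⟩
    refine Types.FilteredColimit.isColimitOf' _ _ ?_ ?_
    · intro m
      obtain ⟨i, y, h⟩ := hsurj m
      exact ⟨i, y, h.symm⟩
    · intro i a b hab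
      have hab' : c i a = c i b := hab
      obtain ⟨j, h, hj⟩ := hker i (a - b) (by rw [map_sub, hab', sub_self])
      refine ⟨j, homOfLE h, ?_⟩
      rw [map_sub, sub_eq_zero] at hj
      exact hj
  obtain ⟨ht⟩ := ht
  have := PreservesCofilteredLimitsOfSize.preserves_cofiltered_limits (F := F) ιᵒᵖ
  -- Points of a limit of sets are exactly the compatible families.
  have hl := isLimitOfPreserves (F ⋙ forget AddCommGrpCat.{u}) ht.op
  have key := (Types.isLimit_iff _).1 ⟨hl⟩ (fun i => x i.unop) (by
    intro i j f
    exact hx _ _ (leOfHom f.unop))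
  obtain ⟨y, hy, hu⟩ := key
  refine ⟨y, fun i => hy (op i), fun z hz => hu z fun i => hz i.unop⟩

/-- Elements glue uniquely over a directed union of submodules by which one takes quotients. -/
lemma existsUnique_glue_quotient {Λ : Type u} [Ring Λ]
    (F : (ModuleCat.{u} Λ)ᵒᵖ ⥤ AddCommGrpCat.{u})
    [PreservesCofilteredLimitsOfSize.{u, u} F] {ι : Type u} [Preorder ι] [IsDirectedOrder ι]
    [Nonempty ι] {X : Type u} [AddCommGroup X] [Module Λ X] (G : ι → Submodule Λ X)
    (hG : Monotone G) (K : Submodule Λ X) (hK : ∀ v, v ∈ K ↔ ∃ i, v ∈ G i)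
    (hle : ∀ i, G i ≤ K)
    (x : ∀ i, F.obj (op (ModuleCat.of Λ (X ⧸ G i))))
    (hx : ∀ i j (h : i ≤ j), elemPull F (Submodule.factor (hG h)) (x j) = x i) :
    ∃! y : F.obj (op (ModuleCat.of Λ (X ⧸ K))),
      ∀ i, elemPull F (Submodule.factor (hle i)) y = x i := by
  let D : ι ⥤ ModuleCat.{u} Λ :=
    { obj i := ModuleCat.of Λ (X ⧸ G i)
      map f := ModuleCat.ofHom (Submodule.factor (hG (leOfHom f)))
      map_id i := by
        ext v
        rfl
      map_comp f g := by
        ext v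
        rfl }
  refine existsUnique_glue F D (fun i => Submodule.factor (hle i)) ?_ ?_ ?_ x hx
  · intro i j h
    apply Submodule.linearMap_qext
    rfl
  · intro m
    obtain ⟨v, rfl⟩ := Submodule.mkQ_surjective _ m
    exact ⟨Classical.arbitrary ι, Submodule.Quotient.mk v, rfl⟩
  · intro i y hy
    obtain ⟨v, rfl⟩ := Submodule.mkQ_surjective _ y
    have hv : v ∈ K := (Submodule.Quotient.mk_eq_zero _).1 hy
    obtain ⟨j, hj⟩ := (hK v).1 hv
    obtain ⟨k, hik, hjk⟩ := exists_ge_ge i j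
    exact ⟨k, hik, (Submodule.Quotient.mk_eq_zero _).2 (hG hjk hj)⟩

/-- Elements glue uniquely over a directed union of submodules. -/
lemma existsUnique_glue_submodule {Λ : Type u} [Ring Λ]
    (F : (ModuleCat.{u} Λ)ᵒᵖ ⥤ AddCommGrpCat.{u})
    [PreservesCofilteredLimitsOfSize.{u, u} F] {ι : Type u} [Preorder ι] [IsDirectedOrder ι]
    [Nonempty ι] {X : Type u} [AddCommGroup X] [Module Λ X] (G : ι → Submodule Λ X)
    (hG : Monotone G) (hX : ∀ v, ∃ i, v ∈ G i)
    (x : ∀ i, F.obj (op (ModuleCat.of Λ (G i))))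
    (hx : ∀ i j (h : i ≤ j), elemPull F (Submodule.inclusion (hG h)) (x j) = x i) :
    ∃! y : F.obj (op (ModuleCat.of Λ X)), ∀ i, elemPull F (G i).subtype y = x i := by
  let D : ι ⥤ ModuleCat.{u} Λ :=
    { obj i := ModuleCat.of Λ (G i)
      map f := ModuleCat.ofHom (Submodule.inclusion (hG (leOfHom f)))
      map_id i := by
        ext v
        rfl
      map_comp f g := by
        ext v
        rfl }
  refine existsUnique_glue F D (fun i => (G i).subtype) ?_ ?_ ?_ x hx
  · intro i j h
    rfl
  · intro m
    obtain ⟨i, hi⟩ := hX m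
    exact ⟨i, ⟨m, hi⟩, rfl⟩
  · intro i y hy
    have hy' : y = 0 := Subtype.ext hy
    subst hy'
    exact ⟨i, le_rfl, map_zero _⟩

/-- Two elements agree if they agree on all quotients of the free module on `M` by finitely
generated submodules of relations. -/
lemma elem_ext_of_fg {Λ : Type u} [Ring Λ] (F : (ModuleCat.{u} Λ)ᵒᵖ ⥤ AddCommGrpCat.{u})
    [PreservesCofilteredLimitsOfSize.{u, u} F] {X M : Type u} [AddCommGroup X] [Module Λ X]
    [AddCommGroup M] [Module Λ M] (L : X →ₗ[Λ] M) (hL : Function.Surjective L)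
    {x y : F.obj (op (ModuleCat.of Λ M))}
    (h : ∀ (G : Submodule Λ X) (hG : G ≤ LinearMap.ker L), G.FG →
      elemPull F (G.liftQ L hG) x = elemPull F (G.liftQ L hG) y) : x = y := by
  let ι := {G : Submodule Λ X // G.FG ∧ G ≤ LinearMap.ker L}
  have : IsDirectedOrder ι :=
    ⟨fun a b => ⟨⟨a.1 ⊔ b.1, a.2.1.sup b.2.1, sup_le a.2.2 b.2.2⟩, le_sup_left (a := a.1),
      le_sup_right (a := a.1)⟩⟩
  have : Nonempty ι := ⟨⟨⊥, Submodule.fg_bot, bot_le⟩⟩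
  let e := L.quotKerEquivOfSurjective hL
  have hu := existsUnique_glue_quotient F (fun i : ι => i.1) (fun _ _ h => h) (LinearMap.ker L)
    (fun v => ⟨fun hv => ⟨⟨Submodule.span Λ {v}, Submodule.fg_span_singleton v,
      (Submodule.span_singleton_le_iff_mem _ _).2 hv⟩, Submodule.mem_span_singleton_self v⟩,
      fun ⟨i, hi⟩ => i.2.2 hi⟩) (fun i => i.2.2)
    (fun i => elemPull F (i.1.liftQ L i.2.2) x) (fun i j hij => by
      rw [← elemPull.comp]
      congr 2
      apply Submodule.linearMap_qext
      rfl)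
  have he : elemPull F e.toLinearMap x = elemPull F e.toLinearMap y := by
    refine hu.unique (fun i => ?_) (fun i => ?_)
    · rw [← elemPull.comp]
      congr 2
      apply Submodule.linearMap_qext
      rfl
    · rw [h i.1 i.2.2 i.2.1, ← elemPull.comp]
      congr 2
      apply Submodule.linearMap_qext
      rfl
  have h2 := congrArg (elemPull F e.symm.toLinearMap) he
  simpa only [← elemPull.comp, LinearEquiv.comp_symm, elemPull.id] using h2

/-! ### Extending an element along a pure quotient -/

/-- If `d : N → M` is such that both `M → M / range d` and `N → range d` are pure epimorphisms,
and `x` restricts to zero along `d`, then `x` extends along a linear map annihilating `range d`. -/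
lemma exists_extension_of_pure {Λ : Type u} [Ring Λ]
    (F : (ModuleCat.{u} Λ)ᵒᵖ ⥤ AddCommGrpCat.{u}) [F.Additive]
    [PreservesCofilteredLimitsOfSize.{u, u} F] {N M : Type u}
    [AddCommGroup N] [Module Λ N] [AddCommGroup M] [Module Λ M] (d : N →ₗ[Λ] M)
    (x : F.obj (op (ModuleCat.of Λ M))) (hx : elemPull F d x = 0)
    (h₁ : ∀ (G : Submodule Λ (M →₀ Λ)) (_ : G.FG) (l : (M →₀ Λ) →ₗ[Λ] M),
      (∀ g ∈ G, l g ∈ LinearMap.range d) → ∃ l' : (M →₀ Λ) →ₗ[Λ] N, ∀ g ∈ G, d (l' g) = l g)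
    (h₂ : ∀ (G : Submodule Λ (M →₀ Λ)) (_ : G.FG) (l : (M →₀ Λ) →ₗ[Λ] N),
      (∀ g ∈ G, d (l g) = 0) →
        ∃ l' : (M →₀ Λ) →ₗ[Λ] N, (∀ g ∈ G, l' g = l g) ∧ ∀ v, d (l' v) = 0) :
    ∃ (P : Type u) (_ : AddCommGroup P) (_ : Module Λ P) (r : M →ₗ[Λ] P)
      (y : F.obj (op (ModuleCat.of Λ P))), elemPull F r y = x ∧ ∀ n, r (d n) = 0 := by
  let L : (M →₀ Λ) →ₗ[Λ] M := Finsupp.linearCombination Λ id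
  have hL : Function.Surjective L := Finsupp.linearCombination_id_surjective Λ M
  let K := (LinearMap.range d).comap L
  have hK : LinearMap.ker L ≤ K := LinearMap.ker_le_comap L
  let r : M →ₗ[Λ] ((M →₀ Λ) ⧸ K) :=
    (LinearMap.ker L).liftQ K.mkQ (by rwa [Submodule.ker_mkQ]) ∘ₗ
      (L.quotKerEquivOfSurjective hL).symm.toLinearMap
  have hr : ∀ v, r (L v) = K.mkQ v := by
    intro v
    have : (L.quotKerEquivOfSurjective hL).symm (L v) = (LinearMap.ker L).mkQ v := by
      rw [LinearEquiv.symm_apply_eq]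
      rfl
    simp only [r, LinearMap.comp_apply, LinearEquiv.coe_coe, this]
    rfl
  -- Maps congruent modulo `range d` pull `x` back equally: by `h₂` their difference factors through
  -- `d`, which kills `x`.
  have key : ∀ (G : Submodule Λ (M →₀ Λ)) (_ : G.FG) (a b : ((M →₀ Λ) ⧸ G) →ₗ[Λ] M),
      (∀ v, a v - b v ∈ LinearMap.range d) → elemPull F a x = elemPull F b x := by
    intro G hG a b hab
    choose c hc using fun m : M => hab (G.mkQ (Finsupp.single m 1))
    let l : (M →₀ Λ) →ₗ[Λ] N := Finsupp.linearCombination Λ c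
    have hl : d ∘ₗ l = (a - b) ∘ₗ G.mkQ := by
      ext m
      simpa [l] using hc m
    obtain ⟨l', hl', hd⟩ := h₂ G hG l (fun g hg => by
      have := LinearMap.congr_fun hl g
      rw [LinearMap.comp_apply] at this
      rw [this, LinearMap.comp_apply, Submodule.mkQ_apply, (Submodule.Quotient.mk_eq_zero G).2 hg,
        map_zero])
    let w : ((M →₀ Λ) ⧸ G) →ₗ[Λ] N := G.liftQ (l - l') (fun g hg => by simp [hl' g hg])
    have hw : a - b = d ∘ₗ w := by
      apply Submodule.linearMap_qext
      ext m
      have := LinearMap.congr_fun hl (Finsupp.single m 1)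
      simp only [LinearMap.comp_apply] at this
      simp only [LinearMap.comp_apply, w, Submodule.mkQ_apply, Submodule.liftQ_apply,
        LinearMap.sub_apply, map_sub, hd, sub_zero, Finsupp.lsingle_apply]
      exact this.symm
    rw [← sub_eq_zero, ← elemPull.sub, hw, elemPull.comp, hx, map_zero]
  -- By `h₁`, the map to `M / range d` lifts to `M` on each finitely presented stage. The pullbacks
  -- of `x` along these lifts are compatible by `key`, so they glue.
  have hs : ∀ (G : Submodule Λ (M →₀ Λ)) (_ : G.FG) (_ : G ≤ K),
      ∃ s : ((M →₀ Λ) ⧸ G) →ₗ[Λ] M, ∀ v, L v - s (G.mkQ v) ∈ LinearMap.range d := by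
    intro G hG hGK
    obtain ⟨l', hl'⟩ := h₁ G hG L (fun g hg => hGK hg)
    exact ⟨G.liftQ (L - d ∘ₗ l') (fun g hg => by simp [hl' g hg]), fun v => ⟨l' v, by simp⟩⟩
  choose s hs using hs
  let ι := {G : Submodule Λ (M →₀ Λ) // G.FG ∧ G ≤ K}
  have : IsDirectedOrder ι :=
    ⟨fun a b => ⟨⟨a.1 ⊔ b.1, a.2.1.sup b.2.1, sup_le a.2.2 b.2.2⟩, le_sup_left (a := a.1),
      le_sup_right (a := a.1)⟩⟩
  have : Nonempty ι := ⟨⟨⊥, Submodule.fg_bot, bot_le⟩⟩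
  obtain ⟨y, hy, -⟩ := existsUnique_glue_quotient F (fun i : ι => i.1) (fun _ _ h => h) K
    (fun v => ⟨fun hv => ⟨⟨Submodule.span Λ {v}, Submodule.fg_span_singleton v,
      (Submodule.span_singleton_le_iff_mem _ _).2 hv⟩, Submodule.mem_span_singleton_self v⟩,
      fun ⟨i, hi⟩ => i.2.2 hi⟩) (fun i => i.2.2)
    (fun i => elemPull F (s i.1 i.2.1 i.2.2) x) (fun i j hij => by
      rw [← elemPull.comp]
      refine key _ i.2.1 _ _ fun v => ?_
      obtain ⟨v, rfl⟩ := Submodule.mkQ_surjective _ v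
      have := sub_mem (hs _ i.2.1 i.2.2 v) (hs _ j.2.1 j.2.2 v)
      rwa [sub_sub_sub_cancel_left] at this)
  refine ⟨_, _, _, r, y, ?_, fun n => ?_⟩
  · refine elem_ext_of_fg F L hL fun G hG hfg => ?_
    have h := hy ⟨G, hfg, hG.trans hK⟩
    rw [← elemPull.comp]
    have h3 : r ∘ₗ G.liftQ L hG = Submodule.factor (hG.trans hK) := by
      apply Submodule.linearMap_qext
      ext1 v
      exact LinearMap.ext fun a => hr _
    rw [h3, h]
    refine key _ hfg _ _ fun v => ?_
    obtain ⟨v, rfl⟩ := Submodule.mkQ_surjective _ v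
    have := neg_mem (hs _ hfg (hG.trans hK) v)
    rwa [neg_sub] at this
  · obtain ⟨v, hv⟩ := hL (d n)
    rw [← hv, hr, Submodule.mkQ_apply, Submodule.Quotient.mk_eq_zero]
    exact ⟨n, hv.symm⟩

/-! ### Löwenheim–Skolem closures -/

open Cardinal in
/-- A Löwenheim–Skolem principle: any small set is contained in a small set that is closed under
solving a given family of systems. -/
lemma exists_skolem_closure {M A ι o : Type u} {μ : Cardinal.{u}} (hμ : ℵ₀ ≤ μ) (hA : #A ≤ μ)
    (ho : #o ≤ μ) (hι : μ ^ #ι ≤ μ) (S : Set M) (hS : #S ≤ μ)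
    (R : A → (ι → M) → (o → M) → Prop) :
    ∃ N : Set M, S ⊆ N ∧ #N ≤ μ ∧
      ∀ a n, (∀ i, n i ∈ N) → (∃ y, R a n y) → ∃ y, (∀ j, y j ∈ N) ∧ R a n y := by
  classical
  by_cases hM : Nonempty M
  swap
  · have := not_nonempty_iff.1 hM
    refine ⟨S, subset_rfl, hS, fun a n hn ⟨y, hy⟩ => ⟨y, fun j => isEmptyElim (y j), hy⟩⟩
  let f : A → (ι → M) → o → M := fun a n =>
    if h : ∃ y, R a n y then h.choose else fun _ => Classical.arbitrary M
  -- The closure consists of the values of well-founded terms, with an `ι`-ary symbol for each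
  -- coordinate of a chosen solution and a constant for each element of `S`.
  let β : (A × o) ⊕ S → Type u := Sum.elim (fun _ => ι) (fun _ => PEmpty)
  let op : (Σ a, (β a → M)) → M := fun p => match p with
    | ⟨Sum.inl a, n⟩ => f a.1 n a.2
    | ⟨Sum.inr s, _⟩ => s
  let N : Set M := Set.range (WType.elim (β := β) M op)
  have hone : 1 ≤ μ := one_le_aleph0.trans hμ
  refine ⟨N, fun s hs => ⟨WType.mk (Sum.inr ⟨s, hs⟩) (fun e => nomatch e), rfl⟩, ?_, ?_⟩
  · refine mk_range_le.trans (WType.cardinalMk_le_of_le ?_)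
    refine (sum_le_mk_mul_iSup _).trans ?_
    have h1 : #((A × o) ⊕ S) ≤ μ := by
      rw [mk_sum, lift_id, lift_id, mk_prod, lift_id, lift_id]
      exact add_le_of_le hμ (mul_le_of_le hμ hA ho) hS
    refine mul_le_of_le hμ h1 (ciSup_le' fun a => ?_)
    rcases a with a | s
    · exact hι
    · change μ ^ #PEmpty ≤ μ
      simpa using hone
  · intro a n hn hex
    choose w hw using hn
    refine ⟨f a n, fun j => ⟨WType.mk (Sum.inl (a, j)) w, ?_⟩, ?_⟩
    · change op ⟨Sum.inl (a, j), fun i => WType.elim M op (w i)⟩ = _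
      exact congrArg (fun n => f a n j) (funext hw)
    · simp only [f, dif_pos hex]
      exact hex.choose_spec

/-- A finitely generated submodule of a free module embeds into a free module of countable rank,
compatibly with the ambient modules and with a retraction. -/
lemma exists_countable_retract {Λ : Type u} [Ring Λ] {J : Type u} [Nonempty J]
    (G : Submodule Λ (J →₀ Λ)) (hG : G.FG) :
    ∃ (a : (J →₀ Λ) →ₗ[Λ] (ULift.{u} ℕ →₀ Λ)) (b : (ULift.{u} ℕ →₀ Λ) →ₗ[Λ] (J →₀ Λ)),
      ∀ g ∈ G, b (a g) = g := by
  classical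
  obtain ⟨S, rfl⟩ := hG
  -- Only countably many basis vectors occur in the generators. An injection of them into `ℕ`
  -- induces `a`, and its inverse on `T` induces `b`.
  let T : Set J := ⋃ s ∈ S, (s.support : Set J)
  have hT : T.Countable := (S.finite_toSet.biUnion fun s _ => s.support.finite_toSet).countable
  obtain ⟨f, hf⟩ := Set.countable_iff_exists_injOn.1 hT
  let f' : J → ULift.{u} ℕ := fun j => ⟨f j⟩
  have hf' : Set.InjOn f' T := fun x hx y hy h => hf hx hy (congrArg ULift.down h)
  refine ⟨Finsupp.lmapDomain Λ Λ f', Finsupp.lmapDomain Λ Λ (Function.invFunOn f' T), ?_⟩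
  suffices h : Submodule.span Λ (S : Set (J →₀ Λ)) ≤ LinearMap.eqLocus
      (Finsupp.lmapDomain Λ Λ (Function.invFunOn f' T) ∘ₗ Finsupp.lmapDomain Λ Λ f')
      LinearMap.id from fun g hg => h hg
  rw [Submodule.span_le]
  intro s hs
  change Finsupp.mapDomain _ (Finsupp.mapDomain _ s) = s
  rw [← Finsupp.mapDomain_comp]
  conv_rhs => rw [← Finsupp.mapDomain_id (v := s)]
  refine Finsupp.mapDomain_congr fun x hx => ?_
  exact hf'.leftInvOn_invFunOn (Set.mem_biUnion hs hx)

open Cardinal in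
/-- A module element is contained in a small submodule that is closed under solving countable
linear systems, part of whose unknowns are constrained to lie in a given subset. -/
lemma exists_submodule_closed_under_systems {Λ : Type u} [Ring Λ] {M : Type u} [AddCommGroup M]
    [Module Λ M] {κ : Cardinal.{u}} (hκ : ℵ₀ ≤ κ) (hΛ : #Λ ≤ κ) (hpow : κ ^ ℵ₀ ≤ κ)
    (B : Set M) (m : M) :
    ∃ N : Submodule Λ M, m ∈ N ∧ #N ≤ κ ∧
      ∀ (Z : Set (ULift.{u} ℕ ⊕ ULift.{u} ℕ))
        (g : ULift.{u} ℕ → (ULift.{u} ℕ ⊕ ULift.{u} ℕ →₀ Λ)) (n : ULift.{u} ℕ → M),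
        (∀ i, n i ∈ N) →
        (∃ y : ULift.{u} ℕ ⊕ ULift.{u} ℕ → M, (∀ j ∈ Z, y j ∈ B) ∧
          ∀ i, Finsupp.linearCombination Λ y (g i) = n i) →
        ∃ y : ULift.{u} ℕ ⊕ ULift.{u} ℕ → M, (∀ j, y j ∈ N) ∧ (∀ j ∈ Z, y j ∈ B) ∧
          ∀ i, Finsupp.linearCombination Λ y (g i) = n i := by
  let W := ULift.{u} ℕ
  have hW : #W = ℵ₀ := by simp [W]
  have ho : #(W ⊕ W) = ℵ₀ := by simp [W]
  have hfs : ∀ o : Type u, #o = ℵ₀ → #(o →₀ Λ) ≤ κ := by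
    intro o ho
    refine (mk_le_of_injective (DFunLike.coe_injective : Function.Injective
      (fun f : o →₀ Λ => (f : o → Λ)))).trans ?_
    rw [← power_def, ho]
    exact (power_le_power_right hΛ).trans hpow
  have hA : #(Set (W ⊕ W) × (W → (W ⊕ W →₀ Λ)) × (W → (W →₀ Λ))) ≤ κ := by
    rw [mk_prod, mk_prod, lift_id, lift_id, lift_id, lift_id, mk_set, ho, ← power_def,
      ← power_def, hW]
    refine mul_le_of_le hκ ?_ (mul_le_of_le hκ ?_ ?_)
    · exact (power_le_power_right ((natCast_le_aleph0 (n := 2)).trans hκ)).trans hpow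
    · exact (power_le_power_right (hfs _ ho)).trans hpow
    · exact (power_le_power_right (hfs _ hW)).trans hpow
  obtain ⟨N, hmN, hN, hcl⟩ := exists_skolem_closure (M := M) (ι := W) (o := W ⊕ W) hκ hA
    (ho.le.trans hκ) (by rwa [hW]) {m} (by simpa using one_le_aleph0.trans hκ)
    (fun a n y => (∀ j ∈ a.1, y j ∈ B) ∧
      ∀ i, Finsupp.linearCombination Λ y (a.2.1 i) = Finsupp.linearCombination Λ n (a.2.2 i))
  have hlin : ∀ (v : W →₀ Λ) (n : W → M), (∀ i, n i ∈ N) →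
      Finsupp.linearCombination Λ n v ∈ N := by
    intro v n hn
    -- The unconstrained system whose equations all set one unknown equal to the combination `v` of
    -- `n` forces that combination into `N`.
    obtain ⟨y, hy, -, h⟩ := hcl (∅, fun _ => Finsupp.single (Sum.inl ⟨0⟩) 1, fun _ => v) n hn
      ⟨fun _ => Finsupp.linearCombination Λ n v, by simp, by simp⟩
    have := h ⟨0⟩
    simp only [Finsupp.linearCombination_single, one_smul] at this
    rw [← this]
    exact hy _
  have hm : m ∈ N := hmN rfl
  let N' : Submodule Λ M :=
    { carrier := N
      zero_mem' := by simpa using hlin 0 (fun _ => m) (fun _ => hm)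
      add_mem' := by
        intro a b ha hb
        have := hlin (Finsupp.single ⟨0⟩ 1 + Finsupp.single ⟨1⟩ 1)
          (fun i => if i.down = 0 then a else b) (fun i => by split_ifs <;> assumption)
        simpa using this
      smul_mem' := by
        intro c a ha
        simpa using hlin (Finsupp.single ⟨0⟩ c) (fun _ => a) (fun _ => ha) }
  refine ⟨N', hm, hN, fun Z g n hn hex => ?_⟩
  have := hcl (Z, g, fun i => Finsupp.single i 1) n hn
    (by simpa only [Finsupp.linearCombination_single, one_smul] using hex)
  simp only [Finsupp.linearCombination_single, one_smul] at this
  exact this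

open Cardinal in
/-- A module contains a small subset in which all small configurations of elements can be
realized, over the part of the configuration already in the subset. -/
lemma exists_subset_realizing_types {Λ : Type u} [Ring Λ]
    (F : (ModuleCat.{u} Λ)ᵒᵖ ⥤ AddCommGrpCat.{u}) {M I : Type u} [AddCommGroup M] [Module Λ M]
    (x : F.obj (op (ModuleCat.of Λ M))) {μ : Cardinal.{u}} (hμ : ℵ₀ ≤ μ) (hI : 2 ^ #I ≤ μ)
    (hpow : μ ^ #I ≤ μ)
    (hF : #(Σ k : Submodule Λ (I →₀ Λ), F.obj (op (ModuleCat.of Λ ((I →₀ Λ) ⧸ k)))) ≤ μ) :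
    ∃ B : Set M, #B ≤ μ ∧ ∀ t : I → M, ∃ t' : I → M, (∀ i, t' i ∈ B) ∧
      (∀ i, t i ∈ B → t' i = t i) ∧
      ∃ h : LinearMap.ker (Finsupp.linearCombination Λ t) ≤
          LinearMap.ker (Finsupp.linearCombination Λ t'),
        elemPull F ((LinearMap.ker (Finsupp.linearCombination Λ t)).liftQ _ h) x =
          elemPull F ((LinearMap.ker (Finsupp.linearCombination Λ t)).liftQ _ le_rfl) x := by
  classical
  obtain ⟨B, h0, hB, hcl⟩ := exists_skolem_closure (M := M) (ι := I) (o := I)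
    (A := Set I × Σ k : Submodule Λ (I →₀ Λ), F.obj (op (ModuleCat.of Λ ((I →₀ Λ) ⧸ k)))) hμ
    (by
      rw [mk_prod, lift_id, lift_id, mk_set]
      exact mul_le_of_le hμ hI hF)
    ((cantor _).le.trans hI) hpow {0} (by simpa using one_le_aleph0.trans hμ)
    (fun a s t => (∀ i ∈ a.1, t i = s i) ∧
      ∃ h : a.2.1 ≤ LinearMap.ker (Finsupp.linearCombination Λ t),
        elemPull F (a.2.1.liftQ _ h) x = a.2.2)
  refine ⟨B, hB, fun t => ?_⟩
  -- The parameters must lie in `B`, so entries of `t` outside `B` are replaced by the default `0`;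
  -- they are not among the indices where agreement is required.
  obtain ⟨t', h1, h2, h3, h4⟩ := hcl ({i | t i ∈ B}, ⟨_, elemPull F
    ((LinearMap.ker (Finsupp.linearCombination Λ t)).liftQ _ le_rfl) x⟩)
    (fun i => if t i ∈ B then t i else 0)
    (fun i => by
      split_ifs with h
      exacts [h, h0 rfl])
    ⟨t, fun i hi => (if_pos hi).symm, le_rfl, rfl⟩
  exact ⟨t', h1, fun i hi => (h2 i hi).trans (if_pos hi), h3, h4⟩

/-! ### Reduced elements and their size -/

/-- An element `x` of `F M` is reduced if every linear map out of `M` along which `x` extends is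
injective. -/
def ElemReduced {Λ : Type u} [Ring Λ] (F : (ModuleCat.{u} Λ)ᵒᵖ ⥤ AddCommGrpCat.{u})
    {M : Type u} [AddCommGroup M] [Module Λ M] (x : F.obj (op (ModuleCat.of Λ M))) : Prop :=
  ∀ (P : Type u) [AddCommGroup P] [Module Λ P] (f : M →ₗ[Λ] P)
    (y : F.obj (op (ModuleCat.of Λ P))), elemPull F f y = x → Function.Injective f

lemma exists_seq_generators {Λ : Type u} [Ring Λ] {X : Type u} [AddCommGroup X] [Module Λ X]
    (G : Submodule Λ X) (hG : G.FG) :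
    ∃ g : ULift.{u} ℕ → X, Submodule.span Λ (Set.range g) = G := by
  obtain ⟨S, rfl⟩ := hG
  obtain ⟨g, hg⟩ := ((S.countable_toSet).insert 0).exists_eq_range (Set.insert_nonempty _ _)
  refine ⟨fun i => g i.down, ?_⟩
  have : Set.range (fun i : ULift.{u} ℕ => g i.down) = Set.range g :=
    ULift.down_surjective.range_comp g
  rw [this, ← hg, Submodule.span_insert_zero]

lemma linearMap_eq_on_span_range {Λ X M ι : Type u} [Ring Λ] [AddCommGroup X] [Module Λ X]
    [AddCommGroup M] [Module Λ M] {g : ι → X} {f f' : X →ₗ[Λ] M} (h : ∀ i, f (g i) = f' (g i)) :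
    ∀ v ∈ Submodule.span Λ (Set.range g), f v = f' v :=
  fun _ hv => LinearMap.eqOn_span' (by rintro _ ⟨i, rfl⟩; exact h i) hv

open Cardinal in
/-- A reduced element lives on a module of bounded cardinality. -/
lemma card_le_of_elemReduced {Λ : Type u} [Ring Λ]
    (F : (ModuleCat.{u} Λ)ᵒᵖ ⥤ AddCommGrpCat.{u}) [F.Additive]
    [PreservesCofilteredLimitsOfSize.{u, u} F] {κ μ : Cardinal.{u}} {I : Type u} (hI : #I = κ)
    (hκ : ℵ₀ ≤ κ) (hΛ : #Λ ≤ κ) (hκpow : κ ^ ℵ₀ ≤ κ) (hμ : 2 ^ κ ≤ μ) (hμpow : μ ^ κ ≤ μ)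
    (hF : #(Σ k : Submodule Λ (I →₀ Λ), F.obj (op (ModuleCat.of Λ ((I →₀ Λ) ⧸ k)))) ≤ μ)
    {M : Type u} [AddCommGroup M] [Module Λ M] (x : F.obj (op (ModuleCat.of Λ M)))
    (hx : ElemReduced F x) : #M ≤ μ := by
  obtain ⟨B, hB, htypes⟩ := exists_subset_realizing_types F (I := I) x
    (hκ.trans ((cantor κ).le.trans hμ)) (by rwa [hI]) (by rwa [hI]) hF
  by_contra! hM
  obtain ⟨m, hm⟩ : ∃ m, m ∉ B := by
    by_contra! h
    have : B = Set.univ := Set.eq_univ_of_forall h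
    rw [this, mk_univ] at hB
    exact absurd hB (not_le.2 hM)
  obtain ⟨N, hmN, hN, hsys⟩ := exists_submodule_closed_under_systems hκ hΛ hκpow B m
  obtain ⟨t, ht⟩ : ∃ t : I → M, Set.range t = N := by
    rw [← hI] at hN
    obtain ⟨f⟩ := hN
    refine ⟨fun i => (Function.invFun f i : N), ?_⟩
    have := (Function.invFun_surjective f.injective).range_comp (Subtype.val : N → M)
    exact this.trans Subtype.range_coe
  obtain ⟨t', ht'B, ht', hle, hpull⟩ := htypes t
  let Q := (I →₀ Λ) ⧸ LinearMap.ker (Finsupp.linearCombination Λ t)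
  let τ : Q →ₗ[Λ] M := (LinearMap.ker (Finsupp.linearCombination Λ t)).liftQ _ le_rfl
  let τ' : Q →ₗ[Λ] M := (LinearMap.ker (Finsupp.linearCombination Λ t)).liftQ _ hle
  let e : I → Q := fun i => Submodule.Quotient.mk (Finsupp.single i 1)
  have hτ : ∀ i, τ (e i) = t i := fun i => by
    change Finsupp.linearCombination Λ t _ = _
    simp
  have hτ' : ∀ i, τ' (e i) = t' i := fun i => by
    change Finsupp.linearCombination Λ t' _ = _
    simp
  have hinj : Function.Injective τ :=
    LinearMap.ker_eq_bot.1 (Submodule.ker_liftQ_eq_bot _ _ _ le_rfl)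
  have htN : ∀ i, t i ∈ N := fun i => by
    change t i ∈ (N : Set M)
    rw [← ht]
    exact Set.mem_range_self i
  have hex : ∀ n ∈ N, ∃ i, t i = n := fun n hn => by
    change n ∈ (N : Set M) at hn
    rwa [← ht] at hn
  have hτN : ∀ q, τ q ∈ N := by
    intro q
    obtain ⟨v, rfl⟩ := Submodule.mkQ_surjective _ q
    change Finsupp.linearCombination Λ t v ∈ N
    rw [Finsupp.linearCombination_apply]
    exact Submodule.sum_mem _ fun i _ => N.smul_mem _ (htN i)
  have hrep : ∀ q, ∃ i, q = e i := fun q => by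
    obtain ⟨i, hi⟩ := hex _ (hτN q)
    exact ⟨i, hinj (by rw [hτ, hi])⟩
  -- Here `Q` is a copy of `N`, and `d` vanishes on the part of it lying in `B`, where `t'` agrees
  -- with `t`.
  let d : Q →ₗ[Λ] M := τ - τ'
  have hd : ∀ i, d (e i) = t i - t' i := fun i => by
    rw [LinearMap.sub_apply, hτ, hτ']
  have hdB : ∀ i, t i ∈ B → d (e i) = 0 := fun i hi => by rw [hd, ht' i hi, sub_self]
  obtain ⟨P, _, _, r, y, hy, hr⟩ := exists_extension_of_pure F d x
    (by rw [elemPull.sub, hpull, sub_self]) (by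
      intro G hG l hl
      obtain ⟨a, b, hab⟩ := exists_countable_retract G hG
      obtain ⟨g, rfl⟩ := exists_seq_generators G hG
      have hg : ∀ i, g i ∈ Submodule.span Λ (Set.range g) :=
        fun i => Submodule.subset_span (Set.mem_range_self i)
      have hc : ∀ i, ∃ c, d (e c) = l (g i) := fun i => by
        obtain ⟨q, hq⟩ := hl _ (hg i)
        obtain ⟨c, rfl⟩ := hrep q
        exact ⟨c, hq⟩
      choose c hc using hc
      -- Left unknowns are values on basis vectors; right unknowns stand for the terms `t' (c i)`
      -- and are confined to `B`. A solution in `N` has right part in `N ∩ B`, where `d` is zero, so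
      -- its left part lifts `l` through `d`.
      obtain ⟨y, hyN, hyB, hy⟩ := hsys (Set.range Sum.inr)
        (fun i => Finsupp.mapDomain Sum.inl (a (g i)) + Finsupp.single (Sum.inr i) 1)
        (fun i => t (c i)) (fun i => htN _)
        ⟨Sum.elim (fun j => l (b (Finsupp.single j 1))) (fun i => t' (c i)), by
          rintro _ ⟨j, rfl⟩
          exact ht'B _, fun i => by
          have h : Finsupp.linearCombination Λ (fun j => l (b (Finsupp.single j 1))) = l ∘ₗ b := by
            ext j
            simp
          rw [map_add, Finsupp.linearCombination_mapDomain, Finsupp.linearCombination_single,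
            Sum.elim_comp_inl, h, LinearMap.comp_apply, hab _ (hg i), ← hc, hd]
          simp⟩
      choose q hq using fun j => hex _ (hyN (Sum.inl j))
      choose z hz using fun j => hex _ (hyN (Sum.inr j))
      refine ⟨Finsupp.linearCombination Λ (e ∘ q) ∘ₗ a, ?_⟩
      refine linearMap_eq_on_span_range (f := d ∘ₗ Finsupp.linearCombination Λ (e ∘ q) ∘ₗ a)
        fun i => ?_
      have h1 : τ ∘ₗ Finsupp.linearCombination Λ (e ∘ q) =
          Finsupp.linearCombination Λ (y ∘ Sum.inl) := by
        ext j
        simp [hτ, hq]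
      have h2 : Finsupp.linearCombination Λ (e ∘ q) (a (g i)) = e (c i) - e (z i) := by
        apply hinj
        have h3 := hy i
        rw [map_add, Finsupp.linearCombination_mapDomain, Finsupp.linearCombination_single,
          one_smul, ← h1, ← hz] at h3
        rw [map_sub, hτ, hτ, ← h3]
        simp
      rw [LinearMap.comp_apply, LinearMap.comp_apply, h2, map_sub, hc,
        hdB _ (by rw [hz]; exact hyB _ ⟨i, rfl⟩), sub_zero]) (by
      intro G hG l hl
      obtain ⟨a, b, hab⟩ := exists_countable_retract G hG
      obtain ⟨g, rfl⟩ := exists_seq_generators G hG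
      have hg : ∀ i, g i ∈ Submodule.span Λ (Set.range g) :=
        fun i => Submodule.subset_span (Set.mem_range_self i)
      choose c hc using fun i => hrep (l (g i))
      choose q hq using fun j => hrep (l (b (Finsupp.single j 1)))
      have hcc : ∀ i, t' (c i) = t (c i) := fun i => by
        have := hl _ (hg i)
        rw [hc, hd, sub_eq_zero] at this
        exact this.symm
      -- Since `d (l (g i)) = 0`, applying `τ'` in place of `τ` gives a solution inside `B`.
      -- Confining all unknowns to `B` then yields a solution in `N ∩ B`, which `d` kills.
      obtain ⟨y, hyN, hyB, hy⟩ := hsys Set.univ (fun i => Finsupp.mapDomain Sum.inl (a (g i)))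
        (fun i => t (c i)) (fun i => htN _)
        ⟨Sum.elim (fun j => t' (q j)) (fun j => t' (q j)), by
          rintro (j | j) -
          exacts [ht'B _, ht'B _], fun i => by
          have h : Finsupp.linearCombination Λ (fun j => t' (q j)) = τ' ∘ₗ l ∘ₗ b := by
            ext j
            simp [hq, hτ']
          rw [Finsupp.linearCombination_mapDomain, Sum.elim_comp_inl, h, LinearMap.comp_apply,
            LinearMap.comp_apply, hab _ (hg i), hc, hτ', hcc]⟩
      choose z hz using fun j => hex _ (hyN (Sum.inl j))
      have h1 : τ ∘ₗ Finsupp.linearCombination Λ (e ∘ z) =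
          Finsupp.linearCombination Λ (y ∘ Sum.inl) := by
        ext j
        simp [hτ, hz]
      refine ⟨Finsupp.linearCombination Λ (e ∘ z) ∘ₗ a, linearMap_eq_on_span_range fun i => ?_,
        fun v => ?_⟩
      · apply hinj
        have h3 := hy i
        rw [Finsupp.linearCombination_mapDomain, ← h1] at h3
        rw [hc, hτ, ← h3]
        rfl
      · have h4 : d ∘ₗ Finsupp.linearCombination Λ (e ∘ z) = 0 := by
          ext j
          simp [hdB (z j) (by rw [hz]; exact hyB _ trivial)]
        exact LinearMap.congr_fun h4 (a v))
  obtain ⟨i, hi⟩ := hex m hmN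
  have h0 : d (e i) = 0 := hx P r y hy ((hr _).trans (map_zero r).symm)
  rw [hd, sub_eq_zero, hi] at h0
  exact hm (h0 ▸ ht'B i)

/-- Every element is the pullback of a reduced one. -/
lemma exists_elemReduced {Λ : Type u} [Ring Λ]
    (F : (ModuleCat.{u} Λ)ᵒᵖ ⥤ AddCommGrpCat.{u})
    [PreservesCofilteredLimitsOfSize.{u, u} F] {M : Type u} [AddCommGroup M] [Module Λ M]
    (x : F.obj (op (ModuleCat.of Λ M))) :
    ∃ (P : Type u) (_ : AddCommGroup P) (_ : Module Λ P) (f : M →ₗ[Λ] P)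
      (y : F.obj (op (ModuleCat.of Λ P))), elemPull F f y = x ∧ ElemReduced F y := by
  let T := Σ K : Submodule Λ M,
    {y : F.obj (op (ModuleCat.of Λ (M ⧸ K))) // elemPull F K.mkQ y = x}
  let _ : Preorder T :=
    { le a b := ∃ h : a.1 ≤ b.1, elemPull F (Submodule.factor h) b.2.1 = a.2.1
      le_refl a := ⟨le_rfl, by
        have : Submodule.factor (le_refl a.1) = LinearMap.id := Submodule.linearMap_qext _ rfl
        rw [this, elemPull.id]⟩
      le_trans := by
        rintro a b c ⟨h₁, h₂⟩ ⟨h₃, h₄⟩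
        refine ⟨h₁.trans h₃, ?_⟩
        rw [← h₂, ← h₄, ← elemPull.comp]
        congr 2
        exact Submodule.linearMap_qext _ rfl }
  obtain ⟨⟨K, y, hy⟩, hmax⟩ : ∃ a : T, ∀ b, a ≤ b → b ≤ a := by
    refine exists_maximal_of_chains_bounded (fun c hc => ?_) le_trans
    rcases c.eq_empty_or_nonempty with rfl | hne
    · refine ⟨⟨⊥, elemPull F (Submodule.quotEquivOfEqBot (⊥ : Submodule Λ M) rfl).toLinearMap x,
        ?_⟩, by simp⟩
      rw [← elemPull.comp]
      exact elemPull.id F x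
    · have : Nonempty c := hne.to_subtype
      have : IsDirectedOrder c := by
        refine ⟨fun a b => ?_⟩
        rcases hc.total a.2 b.2 with h | h
        exacts [⟨b, h, le_rfl⟩, ⟨a, le_rfl, h⟩]
      have hmono : Monotone fun a : c => a.1.1 := fun a b h => h.1
      obtain ⟨y, hy, -⟩ := existsUnique_glue_quotient F (fun a : c => a.1.1) hmono
        (⨆ a : c, a.1.1) (fun v => Submodule.mem_iSup_of_directed _ hmono.directed_le)
        (fun i => le_iSup (fun a : c => a.1.1) i) (fun a => a.1.2.1) (fun a b h => h.2)
      refine ⟨⟨⨆ a : c, a.1.1, y, ?_⟩, fun a ha => ⟨_, hy ⟨a, ha⟩⟩⟩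
      have a := Classical.arbitrary c
      refine Eq.trans ?_ a.1.2.2
      rw [← hy a, ← elemPull.comp]
      rfl
  refine ⟨_, _, _, K.mkQ, y, hy, fun P _ _ f z hz => ?_⟩
  -- If `y` extends along `f`, then `x` also descends to the quotient by this larger kernel, so
  -- maximality makes `f` injective.
  have hK : K ≤ LinearMap.ker (f ∘ₗ K.mkQ) := fun v hv => by
    simp [(Submodule.Quotient.mk_eq_zero K).2 hv]
  have hf : (LinearMap.ker (f ∘ₗ K.mkQ)).liftQ _ le_rfl ∘ₗ Submodule.factor hK = f :=
    Submodule.linearMap_qext _ rfl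
  obtain ⟨h, -⟩ := hmax ⟨LinearMap.ker (f ∘ₗ K.mkQ),
    elemPull F ((LinearMap.ker (f ∘ₗ K.mkQ)).liftQ _ le_rfl) z, by
      rw [← elemPull.comp, ← hy, ← hz, ← elemPull.comp]
      rfl⟩ ⟨hK, by rw [← elemPull.comp, hf, hz]⟩
  rw [← LinearMap.ker_eq_bot, Submodule.eq_bot_iff]
  intro q hq
  obtain ⟨v, rfl⟩ := Submodule.mkQ_surjective _ q
  exact (Submodule.Quotient.mk_eq_zero K).2 (h hq)

/-! ### Weakly terminal elements -/

/-- An element of `F M` is weakly terminal if all elements are pullbacks of it. -/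
def ElemWeaklyTerminal {Λ : Type u} [Ring Λ] (F : (ModuleCat.{u} Λ)ᵒᵖ ⥤ AddCommGrpCat.{u})
    {M : Type u} [AddCommGroup M] [Module Λ M] (x : F.obj (op (ModuleCat.of Λ M))) : Prop :=
  ∀ (N : Type u) [AddCommGroup N] [Module Λ N] (z : F.obj (op (ModuleCat.of Λ N))),
    ∃ f : N →ₗ[Λ] M, elemPull F f x = z

/-- A family of elements is the restriction of an element on the direct sum. -/
lemma exists_elem_of_family {Λ : Type u} [Ring Λ]
    (F : (ModuleCat.{u} Λ)ᵒᵖ ⥤ AddCommGrpCat.{u}) [F.Additive]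
    [PreservesCofilteredLimitsOfSize.{u, u} F] {ι : Type u} (Y : ι → Type u)
    [∀ i, AddCommGroup (Y i)] [∀ i, Module Λ (Y i)]
    (y : ∀ i, F.obj (op (ModuleCat.of Λ (Y i)))) :
    ∃ (X : Type u) (_ : AddCommGroup X) (_ : Module Λ X) (x : F.obj (op (ModuleCat.of Λ X))),
      ∀ i, ∃ f : Y i →ₗ[Λ] X, elemPull F f x = y i := by
  classical
  let X := Π₀ i, Y i
  let p : ∀ i, X →ₗ[Λ] Y i := fun i => DFinsupp.lapply i
  let G : Finset ι → Submodule Λ X := fun S =>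
    { carrier := {v | ∀ i ∉ S, v i = 0}
      zero_mem' := fun i _ => rfl
      add_mem' := fun ha hb i hi =>
        (congrArg₂ (· + ·) (ha i hi) (hb i hi)).trans (add_zero 0)
      smul_mem' := fun c a ha i hi => (congrArg (c • ·) (ha i hi)).trans (smul_zero c) }
  have hG : Monotone G := fun S T h v hv i hi => hv i fun hi' => hi (h hi')
  -- The direct sum is the directed union of its finite subsums, on which additivity supplies the
  -- element.
  obtain ⟨x, hx, -⟩ := existsUnique_glue_submodule F G hG
    (fun v => ⟨v.support, fun i hi => DFinsupp.notMem_support_iff.1 hi⟩)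
    (fun S => ∑ i ∈ S, elemPull F (p i ∘ₗ (G S).subtype) (y i))
    (fun S T h => by
      rw [map_sum]
      refine (Finset.sum_subset h fun i _ hi => ?_).symm.trans
        (Finset.sum_congr rfl fun i hi => ?_)
      · rw [← elemPull.comp]
        have : (p i ∘ₗ (G T).subtype) ∘ₗ Submodule.inclusion (hG h) = 0 :=
          LinearMap.ext fun v => v.2 i hi
        rw [this, elemPull.zero]
      · rw [← elemPull.comp]
        rfl)
  refine ⟨X, _, _, x, fun i => ⟨DFinsupp.lsingle i, ?_⟩⟩
  let s : Y i →ₗ[Λ] G {i} := (DFinsupp.lsingle i : Y i →ₗ[Λ] X).codRestrict (G {i}) fun c j hj =>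
    DFinsupp.single_eq_of_ne (by simpa using hj)
  have h1 : (DFinsupp.lsingle i : Y i →ₗ[Λ] X) = (G {i}).subtype ∘ₗ s := rfl
  have h2 : (p i ∘ₗ (G {i}).subtype) ∘ₗ s = LinearMap.id := LinearMap.ext fun c => by
    change (DFinsupp.single i c : X) i = c
    simp
  rw [h1, elemPull.comp, hx, Finset.sum_singleton, ← elemPull.comp, h2, elemPull.id]

-- The exponentials ensure `κ ^ ℵ₀ ≤ κ` and, for the final bound `μ`, `μ ^ κ ≤ μ`; the cardinal `s`
-- counts the possible types of `κ`-indexed families.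
open Cardinal in
lemma exists_card_bound {Λ : Type u} [Ring Λ]
    (F : (ModuleCat.{u} Λ)ᵒᵖ ⥤ AddCommGrpCat.{u}) [F.Additive]
    [PreservesCofilteredLimitsOfSize.{u, u} F] :
    ∃ μ : Cardinal.{u}, ℵ₀ ≤ μ ∧ ∀ (M : Type u) [AddCommGroup M] [Module Λ M]
      (x : F.obj (op (ModuleCat.of Λ M))), ElemReduced F x → #M ≤ μ := by
  let κ : Cardinal.{u} := 2 ^ max ℵ₀ #Λ
  have hmκ : max ℵ₀ #Λ ≤ κ := (cantor _).le
  have hκ : ℵ₀ ≤ κ := (le_max_left _ _).trans hmκ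
  let s := #(Σ k : Submodule Λ (κ.out →₀ Λ), F.obj (op (ModuleCat.of Λ ((κ.out →₀ Λ) ⧸ k))))
  have hs : max κ s ≤ 2 ^ max κ s := (cantor _).le
  refine ⟨2 ^ max κ s, hκ.trans ((le_max_left _ _).trans hs), fun M _ _ x hx =>
    card_le_of_elemReduced F (mk_out κ) hκ ((le_max_right _ _).trans hmκ) ?_
      (power_le_power_left two_ne_zero (le_max_left _ _)) ?_ ((le_max_right _ _).trans hs) x hx⟩
  · rw [← power_mul, mul_aleph0_eq (le_max_left _ _)]
  · rw [← power_mul, mul_eq_left (hκ.trans (le_max_left _ _)) (le_max_left _ _)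
      (aleph0_pos.trans_le hκ).ne']

open Cardinal in
lemma exists_elemWeaklyTerminal {Λ : Type u} [Ring Λ]
    (F : (ModuleCat.{u} Λ)ᵒᵖ ⥤ AddCommGrpCat.{u}) [F.Additive]
    [PreservesCofilteredLimitsOfSize.{u, u} F] :
    ∃ (X : Type u) (_ : AddCommGroup X) (_ : Module Λ X) (x : F.obj (op (ModuleCat.of Λ X))),
      ElemWeaklyTerminal F x ∧ ElemReduced F x := by
  obtain ⟨μ, -, hμ⟩ := exists_card_bound F
  obtain ⟨X, _, _, x, hx⟩ := exists_elem_of_family F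
    -- Every module of size at most `μ` is a quotient of the free module of rank `μ`, so this family
    -- covers all reduced elements.
    (ι := Σ k : Submodule Λ (μ.out →₀ Λ), F.obj (op (ModuleCat.of Λ ((μ.out →₀ Λ) ⧸ k))))
    (fun i => (μ.out →₀ Λ) ⧸ i.1) (fun i => i.2)
  have hX : ElemWeaklyTerminal F x := by
    intro N _ _ z
    obtain ⟨P, _, _, f, y, rfl, hy⟩ := exists_elemReduced F z
    have hP := hμ P y hy
    rw [← mk_out μ] at hP
    obtain ⟨i⟩ := hP
    let L : (μ.out →₀ Λ) →ₗ[Λ] P := Finsupp.linearCombination Λ (Function.invFun i)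
    have hL : Function.Surjective L :=
      Finsupp.linearCombination_surjective Λ (Function.invFun_surjective i.injective)
    let e := L.quotKerEquivOfSurjective hL
    obtain ⟨g, hg⟩ := hx ⟨LinearMap.ker L, elemPull F e.toLinearMap y⟩
    refine ⟨g ∘ₗ e.symm.toLinearMap ∘ₗ f, ?_⟩
    rw [elemPull.comp, hg, ← elemPull.comp, ← LinearMap.comp_assoc, LinearEquiv.comp_symm,
      LinearMap.id_comp]
  obtain ⟨P, _, _, f, y, rfl, hy⟩ := exists_elemReduced F x
  refine ⟨P, _, _, y, fun N _ _ z => ?_, hy⟩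
  obtain ⟨g, rfl⟩ := hX N z
  exact ⟨f ∘ₗ g, elemPull.comp _ _ _ _⟩

/-! ### Filtered colimits in the category of elements -/

section

variable {Λ : Type u} [Ring Λ] (F : (ModuleCat.{u} Λ)ᵒᵖ ⥤ AddCommGrpCat.{u})

/-- The category of pairs of a module `M` and an element of `F M`. -/
abbrev ElemCat := ((F ⋙ forget AddCommGrpCat.{u}).Elements)ᵒᵖ

namespace ElemCat

/-- The functor forgetting the element. -/
abbrev toModule : ElemCat F ⥤ ModuleCat.{u} Λ :=
  (CategoryOfElements.π (F ⋙ forget AddCommGrpCat.{u})).leftOp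

variable {F}

/-- The element belonging to an object. -/
def elem (T : ElemCat F) : F.obj (op (ModuleCat.of Λ ((toModule F).obj T))) := T.unop.2

lemma elemPull_map {T T' : ElemCat F} (f : T ⟶ T') :
    elemPull F ((toModule F).map f).hom T'.elem = T.elem :=
  f.unop.property

/-- The object given by an element. -/
def mk {M : Type u} [AddCommGroup M] [Module Λ M] (x : F.obj (op (ModuleCat.of Λ M))) :
    ElemCat F := op ⟨op (ModuleCat.of Λ M), x⟩

lemma exists_hom {T T' : ElemCat F} (f : (toModule F).obj T →ₗ[Λ] (toModule F).obj T')
    (hf : elemPull F f T'.elem = T.elem) : ∃ φ : T ⟶ T', ((toModule F).map φ).hom = f :=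
  ⟨Quiver.Hom.op ⟨(ModuleCat.ofHom f).op, hf⟩, rfl⟩

variable (F) in
/-- Objects whose element is both reduced and weakly terminal. -/
def IsGood : ObjectProperty (ElemCat F) := fun T =>
  ElemWeaklyTerminal F T.elem ∧ ElemReduced F T.elem

variable [PreservesCofilteredLimitsOfSize.{u, u} F]

instance (J : Type u) [SmallCategory J] [IsFiltered J] : HasColimitsOfShape J (ElemCat F) := by
  have := PreservesCofilteredLimitsOfSize.preserves_cofiltered_limits (F := F) Jᵒᵖ
  infer_instance

instance (J : Type u) [SmallCategory J] [IsFiltered J] :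
    PreservesColimitsOfShape J (toModule F) := by
  have := PreservesCofilteredLimitsOfSize.preserves_cofiltered_limits (F := F) Jᵒᵖ
  exact preservesColimitsOfShape_leftOp _ _

lemma exists_rep {J : Type u} [SmallCategory J] [IsFiltered J] {D : J ⥤ ElemCat F} {c : Cocone D}
    (hc : IsColimit c) (m : (toModule F).obj c.pt) :
    ∃ j, ∃ y : (toModule F).obj (D.obj j), ((toModule F).map (c.ι.app j)).hom y = m :=
  Concrete.isColimit_exists_rep _ (isColimitOfPreserves (toModule F) hc) m

/-- One leg of the cocone gives weak terminality. For reducedness, a kernel vector comes from some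
stage, and the composite from that stage is injective. -/
instance (J : Type u) [SmallCategory J] [IsFiltered J] :
    (IsGood F).IsClosedUnderColimitsOfShape J where
  colimitsOfShape_le := by
    rintro T ⟨h⟩
    refine ⟨fun N _ _ z => ?_, fun P _ _ f y hy => ?_⟩
    · obtain ⟨j⟩ := IsFiltered.nonempty (C := J)
      obtain ⟨g, rfl⟩ := (h.prop_diag_obj j).1 N z
      refine ⟨((toModule F).map (h.ι.app j)).hom ∘ₗ g, ?_⟩
      rw [elemPull.comp]
      exact congrArg _ (elemPull_map (h.ι.app j))
    · rw [← LinearMap.ker_eq_bot, Submodule.eq_bot_iff]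
      intro m hm
      obtain ⟨j, a, rfl⟩ := exists_rep h.isColimit m
      have hinj := (h.prop_diag_obj j).2 P (f ∘ₗ ((toModule F).map (h.ι.app j)).hom) y (by
        rw [elemPull.comp, hy]
        exact elemPull_map (h.ι.app j))
      have ha : a = 0 := hinj (hm.trans (map_zero _).symm)
      rw [ha, map_zero]

end ElemCat

end

/-! ### Minimality by transfinite iteration -/

open ElemCat in
/-- There is a reduced weakly terminal element all of whose endomorphisms are surjective. -/
lemma exists_isGood_surjective {Λ : Type u} [Ring Λ]
    (F : (ModuleCat.{u} Λ)ᵒᵖ ⥤ AddCommGrpCat.{u}) [F.Additive]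
    [PreservesCofilteredLimitsOfSize.{u, u} F] :
    ∃ T : ElemCat F, IsGood F T ∧ ∀ φ : T ⟶ T, Function.Surjective ((toModule F).map φ).hom := by
  by_contra! hcon
  obtain ⟨X, _, _, x, hx⟩ := exists_elemWeaklyTerminal F
  have hcon' : ∀ T : (IsGood F).FullSubcategory, ∃ φ : T ⟶ T,
      ¬ Function.Surjective ((toModule F).map ((IsGood F).ι.map φ)).hom := fun T => by
    obtain ⟨φ, hφ⟩ := hcon T.obj T.property
    exact ⟨ObjectProperty.homMk φ, hφ⟩
  choose φ hφ using hcon'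
  -- Successor steps keep the object and apply its non-surjective endomorphism; limit steps take
  -- colimits.
  let Φ : SmallObject.SuccStruct (IsGood F).FullSubcategory :=
    { X₀ := ⟨ElemCat.mk x, hx⟩
      succ T := T
      toSucc := φ }
  obtain ⟨μ, hμ, hcard⟩ := exists_card_bound F
  let J := (Order.succ μ).ord.ToType
  have hJ : Cardinal.aleph0 ≤ Order.succ μ := hμ.trans (Order.le_succ μ)
  have : NoMaxOrder J := Cardinal.noMaxOrder hJ
  have : Nonempty J := by
    rw [← Cardinal.mk_ne_zero_iff, Cardinal.mk_ord_toType]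
    exact (Cardinal.aleph0_pos.trans_le hJ).ne'
  let _ : OrderBot J := WellFoundedLT.toOrderBot J
  let _ : SuccOrder J := SuccOrder.ofLinearWellFoundedLT J
  have : HasIterationOfShape J (IsGood F).FullSubcategory :=
    { hasColimitsOfShape_of_isSuccLimit j hj := by
        have : Nonempty (Set.Iio j) := ⟨⟨⊥, hj.bot_lt⟩⟩
        infer_instance
      hasColimitsOfShape := inferInstance }
  let G : J ⥤ ModuleCat.{u} Λ := Φ.iterationFunctor J ⋙ (IsGood F).ι ⋙ toModule F
  let Z : (IsGood F).FullSubcategory := colimit (Φ.iterationFunctor J)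
  let c : ∀ j, G.obj j →ₗ[Λ] (toModule F).obj Z.obj := fun j =>
    ((toModule F).map ((IsGood F).ι.map (colimit.ι (Φ.iterationFunctor J) j))).hom
  have hc : ∀ {i j : J} (h : i ≤ j) a, c j ((G.map (homOfLE h)).hom a) = c i a := by
    intro i j h a
    have h1 := colimit.w (Φ.iterationFunctor J) (homOfLE h)
    have h2 := congrArg (fun f => ((toModule F).map ((IsGood F).ι.map f)).hom a) h1
    simp only [Functor.map_comp, ModuleCat.hom_comp, LinearMap.comp_apply] at h2
    exact h2
  have hinj : ∀ j, Function.Injective (c j) := fun j =>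
    ((Φ.iterationFunctor J).obj j).property.2 _ (c j) Z.obj.elem (elemPull_map _)
  have hns : ∀ j : J, ¬ Function.Surjective (G.map (homOfLE (Order.le_succ j))).hom := by
    intro j hj
    have h1 := Φ.iterationFunctor_map_succ j (not_isMax j)
    apply hφ ((Φ.iterationFunctor J).obj j)
    have h2 : Φ.toSucc _ = (Φ.iterationFunctor J).map (homOfLE (Order.le_succ j)) ≫
        (Φ.iterationFunctorObjSuccIso j (not_isMax j)).hom := by
      rw [h1, Category.assoc, Iso.inv_hom_id, Category.comp_id]
    change Function.Surjective ((toModule F).map ((IsGood F).ι.map (Φ.toSucc _))).hom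
    rw [h2, Functor.map_comp, Functor.map_comp, ModuleCat.hom_comp, LinearMap.coe_comp]
    refine Function.Surjective.comp ?_ hj
    let e := ((IsGood F).ι ⋙ toModule F).mapIso
      (Φ.iterationFunctorObjSuccIso j (not_isMax j))
    exact e.toLinearEquiv.surjective
  -- The stages embed in the colimit as a strictly increasing chain; one new vector per step gives
  -- more than `μ` elements.
  have hz : ∀ j : J, ∃ z, z ∈ LinearMap.range (c (Order.succ j)) ∧ z ∉ LinearMap.range (c j) := by
    intro j
    obtain ⟨b, hb⟩ := not_forall.1 (hns j)
    refine ⟨c _ b, ⟨b, rfl⟩, fun ⟨a, ha⟩ => hb ⟨a, hinj _ ?_⟩⟩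
    rw [hc, ha]
  choose z hz₁ hz₂ using hz
  have hlt : ∀ i j : J, i < j → z i ≠ z j := by
    intro i j hij h
    obtain ⟨a, ha⟩ := hz₁ i
    exact hz₂ j ⟨(G.map (homOfLE (Order.succ_le_of_lt hij))).hom a, by rw [hc, ha, h]⟩
  have hzinj : Function.Injective z := fun i j h => by
    rcases lt_trichotomy i j with h' | h' | h'
    exacts [absurd h (hlt _ _ h'), h', absurd h.symm (hlt _ _ h')]
  have h1 := (Cardinal.mk_le_of_injective hzinj).trans (hcard _ Z.obj.elem Z.property.2)
  rw [Cardinal.mk_ord_toType] at h1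
  exact absurd h1 (not_le.2 (Order.lt_succ μ))

/-- A functor turning filtered colimits into limits admits a weakly terminal element all of whose
endomorphisms are bijective. -/
lemma exists_elem_minimal {Λ : Type u} [Ring Λ]
    (F : (ModuleCat.{u} Λ)ᵒᵖ ⥤ AddCommGrpCat.{u}) [F.Additive]
    [PreservesCofilteredLimitsOfSize.{u, u} F] :
    ∃ (Y : Type u) (_ : AddCommGroup Y) (_ : Module Λ Y) (y : F.obj (op (ModuleCat.of Λ Y))),
      ElemWeaklyTerminal F y ∧ ∀ f : Y →ₗ[Λ] Y, elemPull F f y = y → Function.Bijective f := by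
  obtain ⟨T, hT, hs⟩ := exists_isGood_surjective F
  refine ⟨_, _, _, T.elem, hT.1, fun f hf => ⟨hT.2 _ f _ hf, ?_⟩⟩
  obtain ⟨φ, rfl⟩ := ElemCat.exists_hom f hf
  exact hs φ

/-! ### From elements to presentations -/

/-- The morphism from a representable functor given by an element of an additive functor. -/
def preadditiveYonedaHomOfElem {C : Type u} [Category.{v} C] [Preadditive C]
    (F : Cᵒᵖ ⥤ AddCommGrpCat.{v}) [F.Additive] (Y : C) (y : F.obj (op Y)) :
    preadditiveYoneda.obj Y ⟶ F where
  app M := AddCommGrpCat.ofHom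
    (X := M.unop ⟶ Y) (Y := F.obj M)
    { toFun f := F.map f.op y
      map_zero' := by simp
      map_add' f g := by simp [Functor.map_add] }
  naturality M N f := by
    ext g
    change F.map (f.unop ≫ g).op y = F.map f (F.map g.op y)
    rw [← ConcreteCategory.comp_apply, ← Functor.map_comp]
    rfl

/-- A functor turning filtered colimits into limits admits a right minimal epimorphism from a
representable functor. -/
lemma exists_epi_rightMinimal {Λ : Type u} [Ring Λ]
    (F : (ModuleCat.{u} Λ)ᵒᵖ ⥤ AddCommGrpCat.{u}) [F.Additive]
    [PreservesCofilteredLimitsOfSize.{u, u} F] :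
    ∃ (Y : ModuleCat.{u} Λ) (p : preadditiveYoneda.obj Y ⟶ F), Epi p ∧ RightMinimal p := by
  obtain ⟨Y, _, _, y, hy, hmin⟩ := exists_elem_minimal F
  refine ⟨ModuleCat.of Λ Y, preadditiveYonedaHomOfElem F _ y, ?_, fun φ hφ => ?_⟩
  · have (M : (ModuleCat.{u} Λ)ᵒᵖ) : Epi ((preadditiveYonedaHomOfElem F _ y).app M) := by
      rw [AddCommGrpCat.epi_iff_surjective]
      intro z
      obtain ⟨f, hf⟩ := hy M.unop z
      exact ⟨ModuleCat.ofHom f, hf⟩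
    exact NatTrans.epi_of_epi_app _
  · obtain ⟨f, rfl⟩ := preadditiveYoneda.map_surjective φ
    have h := ConcreteCategory.congr_hom (NatTrans.congr_app hφ (op (ModuleCat.of Λ Y)))
      (𝟙 (ModuleCat.of Λ Y))
    have h' : F.map (𝟙 (ModuleCat.of Λ Y) ≫ f).op y = F.map (𝟙 (ModuleCat.of Λ Y)).op y := h
    have hf : Function.Bijective f.hom := hmin f.hom (by
      simpa [elemPull] using h')
    have : IsIso f := (ConcreteCategory.isIso_iff_bijective f).2 hf
    infer_instance

/-- Limits commute with limits, and the kernel is a pointwise limit of functors preserving them. -/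
lemma preservesCofilteredLimitsOfSize_kernel {C : Type*} [Category C]
    {F G : C ⥤ AddCommGrpCat.{u}} (p : F ⟶ G)
    [PreservesCofilteredLimitsOfSize.{u, u} F] [PreservesCofilteredLimitsOfSize.{u, u} G] :
    PreservesCofilteredLimitsOfSize.{u, u} (kernel p) where
  preserves_cofiltered_limits J _ _ := by
    have := PreservesCofilteredLimitsOfSize.preserves_cofiltered_limits (F := F) J
    have := PreservesCofilteredLimitsOfSize.preserves_cofiltered_limits (F := G) J
    have (j : WalkingParallelPair) : PreservesLimitsOfShape J ((parallelPair p 0).obj j) := by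
      cases j <;> assumption
    have : PreservesLimitsOfShape J (parallelPair p 0).flip :=
      preservesLimitsOfShape_of_evaluation _ _ fun j =>
        inferInstanceAs (PreservesLimitsOfShape J ((parallelPair p 0).obj j))
    exact preservesLimitsOfShape_of_natIso (limitIsoFlipCompLim (parallelPair p 0)).symm

lemma additive_of_mono {C D : Type*} [Category C] [Category D] [Preadditive C] [Preadditive D]
    {F G : C ⥤ D} (i : F ⟶ G) [∀ X, Mono (i.app X)] [G.Additive] : F.Additive where
  map_add {X Y f g} := by
    rw [← cancel_mono (i.app Y), Preadditive.add_comp]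
    simp only [NatTrans.naturality, Functor.map_add, Preadditive.comp_add]

/-- `F : (Mod Λ)ᵒᵖ ⥤ Ab` preserves small cofiltered limits, which means that the contravariant
functor `F` on `Mod Λ` turns filtered colimits in `Mod Λ` into the corresponding limits of abelian
groups. -/
theorem mainTheorem5 (Λ : Type u) [Ring Λ]
    (F : (ModuleCat.{u} Λ)ᵒᵖ ⥤ AddCommGrpCat.{u}) [F.Additive]
    [PreservesCofilteredLimitsOfSize.{u, u} F] :
    Nonempty (MinimalPresentation F) := by
  obtain ⟨Y, p, hp, hpmin⟩ := exists_epi_rightMinimal F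
  have : PreservesCofilteredLimitsOfSize.{u, u} (preadditiveYoneda.obj Y) :=
    ⟨fun J _ _ => inferInstance⟩
  have := preservesCofilteredLimitsOfSize_kernel p
  have : (kernel p).Additive := additive_of_mono (kernel.ι p)
  obtain ⟨X, q, hq, hqmin⟩ := exists_epi_rightMinimal (kernel p)
  refine ⟨⟨X, Y, q ≫ kernel.ι p, p, by simp, ?_, hp, fun φ hφ => ?_, hpmin⟩⟩
  · rw [ShortComplex.exact_iff_epi_kernel_lift]
    have : kernel.lift p (q ≫ kernel.ι p) (by simp) = q := by
      rw [← cancel_mono (kernel.ι p)]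
      simp
    dsimp only
    rwa [this]
  · refine hqmin φ ?_
    rwa [← Category.assoc, cancel_mono] at hφ
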